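/- There is an absolute constant $c>0$ such that for every integer $r\ge 2$ there is an integer $T(r)\ge 1$ with the following property. Let $T\ge T(r)$, put $n=Tr$, let $\mathcal S$ be a complex Hilbert space of dimension $r$ with an orthonormal basis $e_1,\dots,e_r$, and let $v_1,\dots,v_n\in\mathcal S$ form a Parseval frame, that is, $\sum_{i=1}^n |v_i\rangle\langle v_i| = \mathbb 1_{\mathcal S}$. For a permutation $\pi$ of $\{1,\dots,n\}$ and $\Theta=(\theta_1,\dots,\theta_n)\in\mathbb R^n$ define the operators $$L_t^{\pi}(\Theta)=\sum_{l=1}^{r} e^{\mathrm i\theta_{\pi(r(t-1)+l)}}\,|v_{\pi(r(t-1)+l)}\rangle\langle e_l| ,\qquad t=1,\dots,T .$$ Then there exist a permutation $\pi^\star$ and phases $\Theta^\star$ such that $$\Bigl\|\sum_{t=1}^{T} L_t^{\pi^\star}(\Theta^\star)^{\dagger}L_t^{\pi^\star}(\Theta^\star)\Bigr\|_{\mathrm{op}} < c\,\log r \qquad\text{and}\qquad \sum_{t=1}^{T} L_t^{\pi^\star}(\Theta^\star)L_t^{\pi^\star}(\Theta^\star)^{\dagger}=\mathbb 1_{\mathcal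 S}.$$ -/

import Mathlib

open scoped BigOperators

noncomputable section

/-- A finite family of vectors `v` in a complex inner product space `S` is a Parseval frame
if `∑ i, |v i⟩⟨v i| = 1`. -/
def IsParsevalFrame {ι S : Type*} [Fintype ι] [NormedAddCommGroup S] [InnerProductSpace ℂ S]
    (v : ι → S) : Prop :=
  ∑ i, InnerProductSpace.rankOne ℂ (v i) (v i) = ContinuousLinearMap.id ℂ S

/-- The modified frame: `v_j(Θ) = exp(i θ_j) v_j`. -/
def phaseFrame {ι S : Type*} [NormedAddCommGroup S] [InnerProductSpace ℂ S]
    (v : ι → S) (θ : ι → ℝ) (j : ι) : S :=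
  Complex.exp (Complex.I * (θ j : ℂ)) • v j

/-- The operator `L_t^π(Θ) = ∑_l |v_{π(r t + l)}(Θ)⟩⟨e_l|` (with `t` and `l` counted from `0`) of
the `t`-th block of `r` vectors. The map `finProdFinEquiv` sends `(t, l)` to the index
`l + r * t`. -/
def blockOperator {r T : ℕ} {S : Type*} [NormedAddCommGroup S] [InnerProductSpace ℂ S]
    (e : OrthonormalBasis (Fin r) ℂ S) (v : Fin (T * r) → S)
    (π : Equiv.Perm (Fin (T * r))) (θ : Fin (T * r) → ℝ) (t : Fin T) : S →L[ℂ] S :=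
  ∑ l : Fin r, InnerProductSpace.rankOne ℂ (phaseFrame v θ (π (finProdFinEquiv (t, l)))) (e l)

end

/-!
The identity `∑ t, L_t L_t† = 1` holds for every permutation and every choice of phases, since it is
a rearrangement of the Parseval identity. The content is the norm bound for `∑ t, L_t† L_t`, which
is a derandomised matrix Chernoff bound.

*Permutation.* The vectors are sorted by decreasing norm. Since `‖v i‖ ≤ 1` and `∑ ‖v i‖² = r`, the
quantities `m t = ‖first vector of block t‖²` satisfy `∑ m t ≤ 2` (`sum_leading_le_of_antitone`).

*Phases.* In block `t` the phases are the powers `ω ^ (j * l)`, `l < r`, of a primitive `r`-th root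
of unity, with one parameter `j < r` per block. The corresponding positive operators
`X t j = L_t† L_t` have norm at most `1`, because `L_t L_t†` is a part of the Parseval sum, and their
average over `j` is diagonal and at most `m t`, by orthogonality of characters
(`sum_star_mul_synthesisOperator_le`).

*Selection.* For `0 ≤ X ≤ 1` one has `exp X ≤ 1 + (e - 1) X`. With the Golden-Thompson inequality
`tr exp (P + X) ≤ tr (exp P * exp X)` it follows that some `j` increases the trace exponential by a
factor of at most `1 + (e - 1) * m t`. Choosing the parameters block by block gives
`exp ‖∑ t, X t (j t)‖ ≤ tr exp (∑ t, X t (j t)) ≤ r * exp (2 * (e - 1))`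
(`IsPositiveTrace.exists_map_exp_sum_le`), that is, a norm of at most `log r + 2 * (e - 1)`.

The Golden-Thompson inequality (`IsPositiveTrace.map_exp_add_le`) is proved for positive traces on
C⋆-algebras from `tr (a * b) ^ 2 ^ k ≤ tr (a ^ 2 ^ k * b ^ 2 ^ k)` for self-adjoint `a` and `b`,
which is iterated Cauchy-Schwarz, and the Lie-Trotter product formula.
-/

/-! ### Trace inequalities for words in self-adjoint elements -/

/-- A positive tracial functional on a complex star algebra, recorded through its real part `f`:
it is real linear, invariant under `star`, cyclic, and nonnegative on squares `star a * a`. -/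
structure IsPositiveTrace {A : Type*} [Ring A] [StarRing A] [Module ℝ A] (f : A →ₗ[ℝ] ℝ) :
    Prop where
  map_star : ∀ a, f (star a) = f a
  map_mul_comm : ∀ a b, f (a * b) = f (b * a)
  map_star_mul_self_nonneg : ∀ a, 0 ≤ f (star a * a)

namespace IsPositiveTrace

section Algebra

variable {A : Type*} [Ring A] [StarRing A] [Module ℝ A] {f : A →ₗ[ℝ] ℝ}

theorem map_mul_pow_comm (hf : IsPositiveTrace f) (a b : A) (n : ℕ) :
    f ((a * b) ^ n) = f ((b * a) ^ n) := by
  cases n with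
  | zero => simp
  | succ n =>
    have h : SemiconjBy a ((b * a) ^ n) ((a * b) ^ n) :=
      SemiconjBy.pow_right (by simp [SemiconjBy, mul_assoc]) n
    rw [pow_succ, ← mul_assoc, ← h.eq, mul_assoc, hf.map_mul_comm, mul_assoc, ← pow_succ]

theorem map_star_mul_le (hf : IsPositiveTrace f) (a b : A) :
    2 * f (star a * b) ≤ f (star a * a) + f (star b * b) := by
  have h := hf.map_star_mul_self_nonneg (a - b)
  have h1 : f (star b * a) = f (star a * b) := by
    rw [← hf.map_star (star b * a)]; simp
  rw [star_sub, mul_sub, sub_mul, sub_mul, map_sub, map_sub, map_sub, h1] at h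
  linarith

theorem map_mul_le_of_isSelfAdjoint (hf : IsPositiveTrace f) {a b : A} (ha : IsSelfAdjoint a)
    (hb : IsSelfAdjoint b) : 2 * f (a * b) ≤ f (a * a) + f (b * b) := by
  simpa [ha.star_eq, hb.star_eq] using hf.map_star_mul_le a b

/-- Both inequalities for exponent `2 ^ k` are proved by a joint induction: squaring `c` turns
`star c * c` into a cyclic rearrangement of `(star c * c) * (c * star c)`, a product of two
self-adjoint elements, to which the second inequality applies. -/
theorem map_pow_two_pow_le_aux (hf : IsPositiveTrace f) (k : ℕ) :
    (∀ c : A, f (c ^ 2 ^ (k + 1)) ≤ f ((star c * c) ^ 2 ^ k)) ∧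
    (∀ a b : A, IsSelfAdjoint a → IsSelfAdjoint b →
      f ((a * b) ^ 2 ^ k) ≤ f (a ^ 2 ^ k * b ^ 2 ^ k)) := by
  induction k with
  | zero =>
    refine ⟨fun c => ?_, fun a b _ _ => by simp⟩
    have h := hf.map_star_mul_le (star c) c
    rw [star_star, hf.map_mul_comm c (star c)] at h
    simp only [zero_add, pow_one, pow_zero, pow_two]
    linarith
  | succ k ih =>
    obtain ⟨hP, hG⟩ := ih
    refine ⟨fun c => ?_, fun a b ha hb => ?_⟩
    · have hH : IsSelfAdjoint (star c * c) := .star_mul_self c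
      have hK : IsSelfAdjoint (c * star c) := .mul_star_self c
      have hm : ∀ {x : A}, x ^ 2 ^ k * x ^ 2 ^ k = x ^ 2 ^ (k + 1) := fun {x} => by
        rw [← pow_add, pow_succ, mul_two]
      calc f (c ^ 2 ^ (k + 1 + 1)) = f ((c ^ 2) ^ 2 ^ (k + 1)) := by
            rw [← pow_mul, pow_succ' 2 (k + 1)]
        _ ≤ f ((star (c ^ 2) * c ^ 2) ^ 2 ^ k) := hP _
        _ = f ((star c * (star c * c * c)) ^ 2 ^ k) := by simp [pow_two, mul_assoc]
        _ = f (((star c * c) * (c * star c)) ^ 2 ^ k) := by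
            rw [hf.map_mul_pow_comm]; simp only [mul_assoc]
        _ ≤ f ((star c * c) ^ 2 ^ k * (c * star c) ^ 2 ^ k) := hG _ _ hH hK
        _ ≤ f ((star c * c) ^ 2 ^ (k + 1)) := by
            have h := hf.map_mul_le_of_isSelfAdjoint (hH.pow (2 ^ k)) (hK.pow (2 ^ k))
            rw [hm, hm, hf.map_mul_pow_comm c (star c)] at h
            linarith
    · calc f ((a * b) ^ 2 ^ (k + 1)) ≤ f ((star (a * b) * (a * b)) ^ 2 ^ k) := hP _
        _ = f ((b * (a * a * b)) ^ 2 ^ k) := by simp [ha.star_eq, hb.star_eq, mul_assoc]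
        _ = f ((a ^ 2 * b ^ 2) ^ 2 ^ k) := by
            rw [hf.map_mul_pow_comm]; simp only [mul_assoc, pow_two]
        _ ≤ f ((a ^ 2) ^ 2 ^ k * (b ^ 2) ^ 2 ^ k) := hG _ _ (ha.pow 2) (hb.pow 2)
        _ = f (a ^ 2 ^ (k + 1) * b ^ 2 ^ (k + 1)) := by
            rw [← pow_mul, ← pow_mul, ← pow_succ']

theorem map_mul_pow_two_pow_le (hf : IsPositiveTrace f) {a b : A} (ha : IsSelfAdjoint a)
    (hb : IsSelfAdjoint b) (k : ℕ) :
    f ((a * b) ^ 2 ^ k) ≤ f (a ^ 2 ^ k * b ^ 2 ^ k) :=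
  (hf.map_pow_two_pow_le_aux k).2 a b ha hb

end Algebra

end IsPositiveTrace

/-! ### The Lie-Trotter product formula -/

open Filter Topology

section LieTrotter

variable {A : Type*} [NormedRing A] [NormOneClass A]

theorem norm_pow_sub_pow_le {a b : A} {M : ℝ} (ha : ‖a‖ ≤ M) (hb : ‖b‖ ≤ M) (n : ℕ) :
    ‖a ^ (n + 1) - b ^ (n + 1)‖ ≤ (n + 1) * M ^ n * ‖a - b‖ := by
  have hM : 0 ≤ M := (norm_nonneg a).trans ha
  induction n with
  | zero => simp
  | succ n ih =>
    have h : a ^ (n + 1 + 1) - b ^ (n + 1 + 1)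
        = a ^ (n + 1) * (a - b) + (a ^ (n + 1) - b ^ (n + 1)) * b := by
      rw [pow_succ a (n + 1), pow_succ b (n + 1)]; noncomm_ring
    have h1 : ‖a ^ (n + 1)‖ ≤ M ^ (n + 1) :=
      (norm_pow_le a _).trans (pow_le_pow_left₀ (norm_nonneg _) ha _)
    calc ‖a ^ (n + 1 + 1) - b ^ (n + 1 + 1)‖
        ≤ ‖a ^ (n + 1)‖ * ‖a - b‖ + ‖a ^ (n + 1) - b ^ (n + 1)‖ * ‖b‖ := by
          rw [h]
          exact (norm_add_le _ _).trans (add_le_add (norm_mul_le _ _) (norm_mul_le _ _))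
      _ ≤ M ^ (n + 1) * ‖a - b‖ + ((n + 1) * M ^ n * ‖a - b‖) * M := by gcongr
      _ = ((n + 1 : ℕ) + 1) * M ^ (n + 1) * ‖a - b‖ := by push_cast; ring

variable [NormedAlgebra ℝ A]

theorem NormedSpace.norm_exp_le_exp_norm (a : A) : ‖NormedSpace.exp a‖ ≤ Real.exp ‖a‖ := by
  let : NormedAlgebra ℚ A := NormedAlgebra.restrictScalars ℚ ℝ A
  rw [NormedSpace.exp_eq_tsum ℝ, Real.exp_eq_exp_ℝ]
  refine tsum_of_norm_bounded (NormedSpace.expSeries_div_hasSum_exp ‖a‖) fun n => ?_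
  rw [norm_smul, norm_inv, Real.norm_natCast, inv_mul_eq_div]
  gcongr
  exact norm_pow_le a n

/-- The Lie-Trotter product formula. -/
theorem tendsto_exp_mul_exp_pow [CompleteSpace A] (a b : A) :
    Tendsto (fun n : ℕ => (NormedSpace.exp (((n : ℝ) + 1)⁻¹ • a) *
      NormedSpace.exp (((n : ℝ) + 1)⁻¹ • b)) ^ (n + 1)) atTop (𝓝 (NormedSpace.exp (a + b))) := by
  let : NormedAlgebra ℚ A := NormedAlgebra.restrictScalars ℚ ℝ A
  -- the two curves agree to first order at `0`
  have hd : HasDerivAt (fun s : ℝ => NormedSpace.exp (s • a) * NormedSpace.exp (s • b) -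
      NormedSpace.exp (s • (a + b))) 0 0 := by
    have := ((hasDerivAt_exp_smul_const a (0 : ℝ)).mul (hasDerivAt_exp_smul_const b (0 : ℝ))).sub
      (hasDerivAt_exp_smul_const (a + b) (0 : ℝ))
    simpa using! this
  have hs : Tendsto (fun n : ℕ => ((n : ℝ) + 1)⁻¹) atTop (𝓝[≠] 0) := by
    refine tendsto_nhdsWithin_iff.2 ⟨?_, Eventually.of_forall fun n => ?_⟩
    · simpa [one_div] using tendsto_one_div_add_atTop_nhds_zero_nat (𝕜 := ℝ)
    · simp only [Set.mem_compl_iff, Set.mem_singleton_iff]; positivity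
  have hlim := ((hasDerivAt_iff_tendsto_slope.1 hd).comp hs).norm.const_mul
    (Real.exp (‖a‖ + ‖b‖))
  simp only [norm_zero, mul_zero] at hlim
  rw [tendsto_iff_norm_sub_tendsto_zero]
  refine squeeze_zero (fun _ => norm_nonneg _) (fun n => ?_) hlim
  have hn : (0 : ℝ) < (n : ℝ) + 1 := by positivity
  set s : ℝ := ((n : ℝ) + 1)⁻¹ with hsdef
  have hs0 : 0 < s := by positivity
  have hexp : NormedSpace.exp (a + b) = NormedSpace.exp (s • (a + b)) ^ (n + 1) := by
    rw [← NormedSpace.exp_nsmul, ← Nat.cast_smul_eq_nsmul ℝ, smul_smul]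
    simp [hsdef, hn.ne']
  have hnorm : ∀ x : A, ‖s • x‖ = s * ‖x‖ := fun x => by
    rw [norm_smul, Real.norm_of_nonneg hs0.le]
  have h1 : ‖NormedSpace.exp (s • a) * NormedSpace.exp (s • b)‖ ≤
      Real.exp (s * (‖a‖ + ‖b‖)) := by
    refine (norm_mul_le _ _).trans ?_
    rw [mul_add, Real.exp_add, ← hnorm, ← hnorm]
    gcongr <;> exact NormedSpace.norm_exp_le_exp_norm _
  have h2 : ‖NormedSpace.exp (s • (a + b))‖ ≤ Real.exp (s * (‖a‖ + ‖b‖)) := by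
    refine (NormedSpace.norm_exp_le_exp_norm _).trans ?_
    rw [hnorm]
    gcongr
    exact norm_add_le a b
  rw [hexp]
  refine (norm_pow_sub_pow_le h1 h2 n).trans ?_
  have h3 : Real.exp (s * (‖a‖ + ‖b‖)) ^ n ≤ Real.exp (‖a‖ + ‖b‖) := by
    rw [← Real.exp_nat_mul]
    gcongr
    rw [← mul_assoc]
    refine mul_le_of_le_one_left (by positivity) ?_
    rw [hsdef, ← div_eq_mul_inv, div_le_one hn]
    linarith
  have h4 : ‖slope (fun s : ℝ => NormedSpace.exp (s • a) * NormedSpace.exp (s • b) -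
      NormedSpace.exp (s • (a + b))) 0 s‖ =
      (n + 1) * ‖NormedSpace.exp (s • a) * NormedSpace.exp (s • b) -
        NormedSpace.exp (s • (a + b))‖ := by
    rw [slope_def_module, norm_smul]
    simp [hsdef, abs_of_pos hn]
  rw [Function.comp_apply, h4]
  calc _ = Real.exp (s * (‖a‖ + ‖b‖)) ^ n * ((n + 1) * ‖NormedSpace.exp (s • a) *
        NormedSpace.exp (s • b) - NormedSpace.exp (s • (a + b))‖) := by ring
    _ ≤ _ := by gcongr

end LieTrotter

/-! ### The Golden-Thompson inequality and the matrix Chernoff bound -/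

namespace IsPositiveTrace

section CStar

variable {A : Type*} [CStarAlgebra A] {f : A →ₗ[ℝ] ℝ}

/-- The Golden-Thompson inequality. -/
theorem map_exp_add_le [Nontrivial A] (hf : IsPositiveTrace f) (hc : Continuous f) {a b : A}
    (ha : IsSelfAdjoint a) (hb : IsSelfAdjoint b) :
    f (NormedSpace.exp (a + b)) ≤ f (NormedSpace.exp a * NormedSpace.exp b) := by
  let : NormedAlgebra ℚ A := NormedAlgebra.restrictScalars ℚ ℝ A
  -- the trace inequality is available along the exponents `2 ^ k` of the product formula
  have hN : Tendsto (fun k : ℕ => 2 ^ k - 1) atTop atTop :=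
    tendsto_atTop_mono (fun k => Nat.le_sub_one_of_lt Nat.lt_two_pow_self) tendsto_id
  have hlim := (hc.tendsto _).comp ((tendsto_exp_mul_exp_pow a b).comp hN)
  refine le_of_tendsto' hlim fun k => ?_
  have hcast : ((2 ^ k - 1 : ℕ) : ℝ) + 1 = ((2 ^ k : ℕ) : ℝ) := by
    rw [← Nat.cast_add_one, Nat.sub_add_cancel Nat.one_le_two_pow]
  have hexp : ∀ x : A, NormedSpace.exp ((((2 ^ k : ℕ) : ℝ))⁻¹ • x) ^ 2 ^ k =
      NormedSpace.exp x := fun x => by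
    rw [← NormedSpace.exp_nsmul, ← Nat.cast_smul_eq_nsmul ℝ, smul_smul, mul_inv_cancel₀, one_smul]
    positivity
  have hsa : ∀ {x : A}, IsSelfAdjoint x →
      IsSelfAdjoint (NormedSpace.exp ((((2 ^ k : ℕ) : ℝ))⁻¹ • x)) := fun {x} hx =>
    (IsSelfAdjoint.smul (.all _) hx).exp
  simp only [Function.comp_apply, hcast, Nat.sub_add_cancel (Nat.one_le_two_pow (n := k))]
  refine (hf.map_mul_pow_two_pow_le (hsa ha) (hsa hb) k).trans_eq ?_
  rw [hexp, hexp]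

variable [PartialOrder A] [StarOrderedRing A]

theorem map_nonneg (hf : IsPositiveTrace f) {a : A} (ha : 0 ≤ a) : 0 ≤ f a := by
  obtain ⟨b, rfl⟩ := CStarAlgebra.nonneg_iff_eq_star_mul_self.1 ha
  exact hf.map_star_mul_self_nonneg b

theorem map_mul_le_map_mul (hf : IsPositiveTrace f) {a b c : A} (ha : 0 ≤ a) (hbc : b ≤ c) :
    f (a * b) ≤ f (a * c) := by
  obtain ⟨d, rfl⟩ := CStarAlgebra.nonneg_iff_eq_star_mul_self.1 ha
  have h := hf.map_nonneg (star_right_conjugate_nonneg (sub_nonneg.2 hbc) d)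
  rw [hf.map_mul_comm, ← mul_assoc, mul_sub, map_sub] at h
  linarith

end CStar

end IsPositiveTrace

section CStar

variable {A : Type*} [CStarAlgebra A] [PartialOrder A] [StarOrderedRing A]

/-- The chord bound `exp x ≤ 1 + (e - 1) x` on `[0, 1]`, in the functional calculus. -/
theorem exp_le_one_add_smul {a : A} (h0 : 0 ≤ a) (h1 : a ≤ 1) :
    NormedSpace.exp a ≤ 1 + (Real.exp 1 - 1) • a := by
  have ha : IsSelfAdjoint a := .of_nonneg h0
  have hspec : ∀ x ∈ spectrum ℝ a, 0 ≤ x ∧ x ≤ 1 := fun x hx =>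
    ⟨spectrum_nonneg_of_nonneg h0 hx, by
      have := (le_algebraMap_iff_spectrum_le (r := (1 : ℝ)) (a := a)).1 (by simpa using h1)
      exact this x hx⟩
  have h : cfc Real.exp a ≤ cfc (fun x : ℝ => 1 + (Real.exp 1 - 1) * x) a := by
    refine cfc_mono fun x hx => ?_
    obtain ⟨hx0, hx1⟩ := hspec x hx
    have := convexOn_exp.2 (Set.mem_univ (0 : ℝ)) (Set.mem_univ (1 : ℝ)) (sub_nonneg.2 hx1) hx0
      (by ring)
    simp only [smul_eq_mul, mul_zero, mul_one, zero_add, Real.exp_zero] at this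
    linarith
  rw [CFC.real_exp_eq_normedSpace_exp ha, cfc_const_add (1 : ℝ) (fun x => (Real.exp 1 - 1) * x) a,
    cfc_const_mul_id (Real.exp 1 - 1) a] at h
  simpa using h

/-- The matrix Chernoff bound of Ahlswede and Winter, in derandomised form. If the choices
available for the `t`-th summand lie between `0` and `1` and average to at most `m t`, then the
summands can be chosen one after the other so that the trace exponential grows by a factor of at
most `1 + (e - 1) * m t ≤ exp ((e - 1) * m t)` each time. -/
theorem IsPositiveTrace.exists_map_exp_sum_le [Nontrivial A] {f : A →ₗ[ℝ] ℝ}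
    (hf : IsPositiveTrace f) (hc : Continuous f) {τ ι : Type*} [Fintype ι] [Nonempty ι]
    (X : τ → ι → A) (m : τ → ℝ) (h0 : ∀ t j, 0 ≤ X t j) (h1 : ∀ t j, X t j ≤ 1)
    (hm : ∀ t, ∑ j, X t j ≤ (Fintype.card ι * m t) • (1 : A)) (s : Finset τ) :
    ∃ J : τ → ι, f (NormedSpace.exp (∑ t ∈ s, X t (J t))) ≤
      Real.exp ((Real.exp 1 - 1) * ∑ t ∈ s, m t) * f 1 := by
  classical
  let : NormedAlgebra ℚ A := NormedAlgebra.restrictScalars ℚ ℝ A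
  induction s using Finset.induction_on with
  | empty => exact ⟨fun _ => Classical.arbitrary ι, by simp⟩
  | insert t s hts ih =>
    obtain ⟨J, hJ⟩ := ih
    set P := ∑ u ∈ s, X u (J u)
    have hP : IsSelfAdjoint P := .of_nonneg (Finset.sum_nonneg fun u _ => h0 u _)
    have hE : 0 ≤ NormedSpace.exp P := hP.exp_nonneg
    have hfE : 0 ≤ f (NormedSpace.exp P) := hf.map_nonneg hE
    have he : 0 ≤ Real.exp 1 - 1 := by linarith [Real.add_one_le_exp (1 : ℝ)]
    have hsum : ∑ j, f (NormedSpace.exp (P + X t j)) ≤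
        ∑ _j : ι, Real.exp ((Real.exp 1 - 1) * m t) * f (NormedSpace.exp P) := by
      calc ∑ j, f (NormedSpace.exp (P + X t j))
          ≤ ∑ j, f (NormedSpace.exp P * (1 + (Real.exp 1 - 1) • X t j)) :=
            Finset.sum_le_sum fun j _ =>
              (hf.map_exp_add_le hc hP (.of_nonneg (h0 t j))).trans
                (hf.map_mul_le_map_mul hE (exp_le_one_add_smul (h0 t j) (h1 t j)))
        _ = Fintype.card ι * f (NormedSpace.exp P) +
              (Real.exp 1 - 1) * f (NormedSpace.exp P * ∑ j, X t j) := by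
            rw [Finset.mul_sum, map_sum, Finset.mul_sum]
            simp only [mul_add, mul_one, map_add, mul_smul_comm, map_smul, smul_eq_mul,
              Finset.sum_add_distrib, Finset.sum_const, Finset.card_univ, nsmul_eq_mul]
        _ ≤ Fintype.card ι * f (NormedSpace.exp P) +
              (Real.exp 1 - 1) * (Fintype.card ι * m t * f (NormedSpace.exp P)) := by
            gcongr
            refine (hf.map_mul_le_map_mul hE (hm t)).trans_eq ?_
            rw [mul_smul_comm, mul_one, map_smul, smul_eq_mul]
        _ = Fintype.card ι * (((Real.exp 1 - 1) * m t + 1) * f (NormedSpace.exp P)) := by ring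
        _ ≤ Fintype.card ι * (Real.exp ((Real.exp 1 - 1) * m t) * f (NormedSpace.exp P)) := by
            gcongr
            exact Real.add_one_le_exp _
        _ = _ := by simp
    obtain ⟨j, -, hj⟩ := Finset.exists_le_of_sum_le Finset.univ_nonempty hsum
    refine ⟨Function.update J t j, ?_⟩
    have hupd : ∑ u ∈ insert t s, X u (Function.update J t j u) = P + X t j := by
      rw [Finset.sum_insert hts, Function.update_self, add_comm]
      congr 1
      refine Finset.sum_congr rfl fun u hu => ?_
      rw [Function.update_of_ne (ne_of_mem_of_not_mem hu hts)]
    rw [hupd, Finset.sum_insert hts, mul_add, Real.exp_add, mul_assoc]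
    exact hj.trans (by gcongr)

end CStar

/-! ### The trace of operators on a finite-dimensional Hilbert space -/

section Trace

variable {S : Type*} [NormedAddCommGroup S] [InnerProductSpace ℂ S]

/-- The real part of the trace, as a real linear functional on the operators on `S`. -/
noncomputable def reTrace (S : Type*) [NormedAddCommGroup S] [InnerProductSpace ℂ S] :
    (S →L[ℂ] S) →ₗ[ℝ] ℝ :=
  Complex.reLm ∘ₗ (LinearMap.trace ℂ S ∘ₗ ContinuousLinearMap.coeLM ℂ).restrictScalars ℝ

theorem reTrace_apply (a : S →L[ℂ] S) : reTrace S a = (LinearMap.trace ℂ S a).re := rfl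

variable {ι : Type*} [Fintype ι]

theorem reTrace_eq_sum (e : OrthonormalBasis ι ℂ S)
    (a : S →L[ℂ] S) : reTrace S a = ∑ i, (inner ℂ (e i) (a (e i))).re := by
  rw [reTrace_apply, LinearMap.trace_eq_sum_inner _ e, Complex.re_sum]
  rfl

theorem reTrace_one (e : OrthonormalBasis ι ℂ S) :
    reTrace S 1 = Fintype.card ι := by
  simp [reTrace_eq_sum e]

theorem continuous_reTrace (e : OrthonormalBasis ι ℂ S) :
    Continuous (reTrace S) := by
  have : (reTrace S : (S →L[ℂ] S) → ℝ) = fun a => ∑ i, (inner ℂ (e i) (a (e i))).re :=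
    funext (reTrace_eq_sum e)
  rw [this]
  fun_prop

variable [CompleteSpace S]

theorem reTrace_star_mul_self (e : OrthonormalBasis ι ℂ S)
    (a : S →L[ℂ] S) : reTrace S (star a * a) = ∑ i, ‖a (e i)‖ ^ 2 := by
  rw [reTrace_eq_sum e]
  refine Finset.sum_congr rfl fun i _ => ?_
  rw [ContinuousLinearMap.star_eq_adjoint, mul_apply_eq_comp,
    ContinuousLinearMap.adjoint_inner_right, inner_self_eq_norm_sq_to_K]
  norm_cast

theorem isPositiveTrace_reTrace (e : OrthonormalBasis ι ℂ S) :
    IsPositiveTrace (reTrace S) where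
  map_star a := by
    rw [reTrace_eq_sum e, reTrace_eq_sum e]
    refine Finset.sum_congr rfl fun i _ => ?_
    rw [ContinuousLinearMap.star_eq_adjoint, ContinuousLinearMap.adjoint_inner_right,
      ← inner_conj_symm, Complex.conj_re]
  map_mul_comm a b := by
    rw [reTrace_apply, reTrace_apply]
    exact congrArg Complex.re (LinearMap.trace_mul_comm ℂ (a : S →ₗ[ℂ] S) (b : S →ₗ[ℂ] S))
  map_star_mul_self_nonneg a := by
    rw [reTrace_star_mul_self e]
    positivity

/-- The operator norm is at most the Hilbert-Schmidt norm. -/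
theorem norm_sq_le_reTrace_star_mul_self (e : OrthonormalBasis ι ℂ S)
    (a : S →L[ℂ] S) :
    ‖a‖ ^ 2 ≤ reTrace S (star a * a) := by
  rw [reTrace_star_mul_self e]
  have h : ‖a‖ ≤ √(∑ i, ‖a (e i)‖ ^ 2) := by
    refine ContinuousLinearMap.opNorm_le_bound _ (Real.sqrt_nonneg _) fun x => ?_
    have hx : a x = ∑ i, inner ℂ (e i) x • a (e i) := by
      conv_lhs => rw [← e.sum_repr' x]
      simp
    calc ‖a x‖ ≤ ∑ i, ‖inner ℂ (e i) x‖ * ‖a (e i)‖ := by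
          rw [hx]
          exact (norm_sum_le _ _).trans_eq (by simp [norm_smul])
      _ ≤ √(∑ i, ‖inner ℂ (e i) x‖ ^ 2) * √(∑ i, ‖a (e i)‖ ^ 2) :=
          Real.sum_mul_le_sqrt_mul_sqrt _ _ _
      _ = √(∑ i, ‖a (e i)‖ ^ 2) * ‖x‖ := by
          rw [e.sum_sq_norm_inner_right, Real.sqrt_sq (norm_nonneg x), mul_comm]
  calc ‖a‖ ^ 2 ≤ √(∑ i, ‖a (e i)‖ ^ 2) ^ 2 := by gcongr
    _ = _ := Real.sq_sqrt (by positivity)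

theorem norm_le_reTrace_of_nonneg (e : OrthonormalBasis ι ℂ S)
    {a : S →L[ℂ] S} (ha : 0 ≤ a) : ‖a‖ ≤ reTrace S a := by
  obtain ⟨b, rfl⟩ := CStarAlgebra.nonneg_iff_eq_star_mul_self.1 ha
  rw [CStarRing.norm_star_mul_self, ← pow_two]
  exact norm_sq_le_reTrace_star_mul_self e b

/-- The largest eigenvalue of `exp a` is one of the nonnegative terms of its trace. -/
theorem exp_norm_le_reTrace_exp (e : OrthonormalBasis ι ℂ S)
    [Nontrivial S] {a : S →L[ℂ] S} (ha : 0 ≤ a) :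
    Real.exp ‖a‖ ≤ reTrace S (NormedSpace.exp a) := by
  have hsa : IsSelfAdjoint a := .of_nonneg ha
  have hmem : Real.exp ‖a‖ ∈ spectrum ℝ (NormedSpace.exp a) := by
    rw [← CFC.real_exp_eq_normedSpace_exp hsa, cfc_map_spectrum Real.exp a]
    exact ⟨‖a‖, CStarAlgebra.norm_mem_spectrum_of_nonneg ha, rfl⟩
  calc Real.exp ‖a‖ = ‖Real.exp ‖a‖‖ := (Real.norm_of_nonneg (Real.exp_pos _).le).symm
    _ ≤ ‖NormedSpace.exp a‖ := spectrum.norm_le_norm_of_mem hmem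
    _ ≤ _ := norm_le_reTrace_of_nonneg e hsa.exp_nonneg

end Trace

/-! ### Parseval frames -/

section Frame

variable {S : Type*} [NormedAddCommGroup S] [InnerProductSpace ℂ S]

theorem IsParsevalFrame.sum_norm_inner_sq {ι : Type*} [Fintype ι] {v : ι → S}
    (hv : IsParsevalFrame v) (x : S) : ∑ i, ‖inner ℂ (v i) x‖ ^ 2 = ‖x‖ ^ 2 := by
  have h : inner ℂ x ((∑ i, InnerProductSpace.rankOne ℂ (v i) (v i)) x) = inner ℂ x x := by
    rw [show ∑ i, InnerProductSpace.rankOne ℂ (v i) (v i) = ContinuousLinearMap.id ℂ S from hv]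
    rfl
  rw [inner_self_eq_norm_sq_to_K, sum_apply, inner_sum] at h
  have h2 : ∀ i, inner ℂ x (InnerProductSpace.rankOne ℂ (v i) (v i) x) =
      ((‖inner ℂ (v i) x‖ ^ 2 : ℝ) : ℂ) := fun i => by
    rw [InnerProductSpace.rankOne_apply, inner_smul_right, ← inner_conj_symm x (v i),
      Complex.mul_conj, Complex.normSq_eq_norm_sq]
  simp only [h2] at h
  rw [← Complex.ofReal_sum] at h
  exact Complex.ofReal_injective (by rw [h]; norm_cast)

theorem IsParsevalFrame.norm_sq_le_one {ι : Type*} [Fintype ι] {v : ι → S}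
    (hv : IsParsevalFrame v) (i : ι) : ‖v i‖ ^ 2 ≤ 1 := by
  have h : ‖inner ℂ (v i) (v i)‖ ^ 2 ≤ ‖v i‖ ^ 2 := by
    rw [← hv.sum_norm_inner_sq (v i)]
    exact Finset.single_le_sum (f := fun j => ‖inner ℂ (v j) (v i)‖ ^ 2)
      (fun _ _ => by positivity) (Finset.mem_univ i)
  rw [inner_self_eq_norm_sq_to_K, norm_pow, RCLike.norm_ofReal, abs_norm] at h
  by_contra! hlt
  nlinarith

theorem IsParsevalFrame.sum_norm_sq {ι κ : Type*} [Fintype ι] [Fintype κ] {v : ι → S}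
    (hv : IsParsevalFrame v) (e : OrthonormalBasis κ ℂ S) :
    ∑ i, ‖v i‖ ^ 2 = Fintype.card κ := by
  have h : ∀ i, ‖v i‖ ^ 2 = ∑ k, ‖inner ℂ (v i) (e k)‖ ^ 2 := fun i =>
    (e.sum_sq_norm_inner_left (v i)).symm
  simp_rw [h]
  rw [Finset.sum_comm]
  simp [hv.sum_norm_inner_sq]

theorem rankOne_phaseFrame {ι : Type*} (v : ι → S) (θ : ι → ℝ) (j : ι) :
    InnerProductSpace.rankOne ℂ (phaseFrame v θ j) (phaseFrame v θ j) =
      InnerProductSpace.rankOne ℂ (v j) (v j) := by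
  ext x
  simp only [phaseFrame, InnerProductSpace.rankOne_apply, inner_smul_left, smul_smul]
  congr 1
  rw [mul_right_comm, mul_comm ((starRingEnd ℂ) _), Complex.mul_conj, Complex.normSq_eq_norm_sq,
    mul_comm Complex.I, Complex.norm_exp_ofReal_mul_I]
  simp

/-- The leading entries of the rows of a decreasing array of numbers in `[0, 1]` of total `r` sum to
at most `2`: each leading entry other than the first is at most the mean of the row above it, and
these means add up to at most `1`. -/
theorem sum_leading_le_of_antitone {r : ℕ} (hr : 0 < r) {T : ℕ} {a : Fin (T * r) → ℝ}
    (ha : Antitone a) (h0 : ∀ i, 0 ≤ a i) (h1 : ∀ i, a i ≤ 1) (hs : ∑ i, a i = r) :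
    ∑ t : Fin T, a (finProdFinEquiv (t, ⟨0, hr⟩)) ≤ 2 := by
  have hr' : (0 : ℝ) < r := by exact_mod_cast hr
  have hrow : ∑ t : Fin T, ∑ l : Fin r, a (finProdFinEquiv (t, l)) = r := by
    rw [← hs, ← finProdFinEquiv.sum_comp a, Fintype.sum_prod_type]
  cases T with
  | zero => simp
  | succ T =>
    rw [Fin.sum_univ_succ]
    have h : ∀ t : Fin T, r * a (finProdFinEquiv (t.succ, ⟨0, hr⟩)) ≤
        ∑ l : Fin r, a (finProdFinEquiv (t.castSucc, l)) := fun t => by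
      calc r * a (finProdFinEquiv (t.succ, ⟨0, hr⟩))
          = ∑ _l : Fin r, a (finProdFinEquiv (t.succ, ⟨0, hr⟩)) := by simp
        _ ≤ _ := Finset.sum_le_sum fun l _ => ha (by
            rw [Fin.le_def]
            simp only [finProdFinEquiv_apply_val, Fin.val_castSucc, Fin.val_succ]
            have := l.2
            rw [mul_add]
            omega)
    have h2 : r * ∑ t : Fin T, a (finProdFinEquiv (t.succ, ⟨0, hr⟩)) ≤ r * 1 := by
      rw [Finset.mul_sum, mul_one]
      refine (Finset.sum_le_sum fun t _ => h t).trans ?_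
      rw [← hrow, Fin.sum_univ_castSucc (n := T)]
      exact le_add_of_nonneg_right (Finset.sum_nonneg fun l _ => h0 _)
    linarith [h1 (finProdFinEquiv ((0 : Fin (T + 1)), ⟨0, hr⟩)), le_of_mul_le_mul_left h2 hr']

end Frame

/-! ### Frame blocks with Fourier phases -/

section Block

variable {S : Type*} [NormedAddCommGroup S] [InnerProductSpace ℂ S]

/-- The operator `∑ l, |u l⟩⟨e l|` sending the basis vector `e l` to `u l`. -/
noncomputable def synthesisOperator {ι : Type*} [Fintype ι] (e : OrthonormalBasis ι ℂ S)
    (u : ι → S) : S →L[ℂ] S :=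
  ∑ l, InnerProductSpace.rankOne ℂ (u l) (e l)

theorem synthesisOperator_apply {ι : Type*} [Fintype ι] (e : OrthonormalBasis ι ℂ S)
    (u : ι → S) (x : S) : synthesisOperator e u x = ∑ l, inner ℂ (e l) x • u l := by
  simp [synthesisOperator, sum_apply]

theorem star_synthesisOperator_apply [CompleteSpace S] {ι : Type*} [Fintype ι]
    (e : OrthonormalBasis ι ℂ S) (u : ι → S) (x : S) :
    star (synthesisOperator e u) x = ∑ l, inner ℂ (u l) x • e l := by
  simp [synthesisOperator, ContinuousLinearMap.star_eq_adjoint, sum_apply]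

theorem synthesisOperator_mul_star [CompleteSpace S] {ι : Type*} [Fintype ι]
    (e : OrthonormalBasis ι ℂ S) (u : ι → S) :
    synthesisOperator e u * star (synthesisOperator e u) =
      ∑ l, InnerProductSpace.rankOne ℂ (u l) (u l) := by
  classical
  ext x
  rw [mul_apply_eq_comp, star_synthesisOperator_apply, synthesisOperator_apply, sum_apply]
  refine Finset.sum_congr rfl fun l _ => ?_
  simp [orthonormal_iff_ite.1 e.orthonormal]

/-- A family satisfying Bessel's inequality has a contractive synthesis operator, because the
adjoint `x ↦ (⟪u l, x⟫)` is contractive. -/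
theorem norm_synthesisOperator_le_one [CompleteSpace S] {ι : Type*} [Fintype ι]
    (e : OrthonormalBasis ι ℂ S) {u : ι → S}
    (hu : ∀ x, ∑ l, ‖inner ℂ (u l) x‖ ^ 2 ≤ ‖x‖ ^ 2) : ‖synthesisOperator e u‖ ≤ 1 := by
  rw [← norm_star]
  refine ContinuousLinearMap.opNorm_le_bound _ zero_le_one fun x => ?_
  rw [one_mul, ← abs_norm, ← abs_norm x, ← sq_le_sq, ← e.sum_sq_norm_inner_right]
  refine le_trans (le_of_eq ?_) (hu x)
  classical
  refine Finset.sum_congr rfl fun l _ => ?_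
  rw [star_synthesisOperator_apply]
  simp [inner_sum, inner_smul_right, orthonormal_iff_ite.1 e.orthonormal]

theorem sum_star_mul_self_le_smul_one [CompleteSpace S] {κ : Type*} [Fintype κ]
    (L : κ → S →L[ℂ] S) {c : ℝ} (h : ∀ x, ∑ j, ‖L j x‖ ^ 2 ≤ c * ‖x‖ ^ 2) :
    ∑ j, star (L j) * L j ≤ c • (1 : S →L[ℂ] S) := by
  rw [ContinuousLinearMap.le_def, ContinuousLinearMap.isPositive_def']
  refine ⟨?_, fun x => ?_⟩
  · exact ((IsSelfAdjoint.all c).smul (.one _)).sub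
      (isSelfAdjoint_sum _ fun j _ => .star_mul_self (L j))
  · have h1 : ∀ j, inner ℂ ((star (L j) * L j) x) x = ((‖L j x‖ ^ 2 : ℝ) : ℂ) := fun j => by
      rw [ContinuousLinearMap.star_eq_adjoint, mul_apply_eq_comp,
        ContinuousLinearMap.adjoint_inner_left, inner_self_eq_norm_sq_to_K]
      norm_cast
    have h2 : inner ℂ ((c • (1 : S →L[ℂ] S)) x) x = ((c * ‖x‖ ^ 2 : ℝ) : ℂ) := by
      rw [smul_apply, one_apply_eq_self, ← Complex.coe_smul, inner_smul_left,
        inner_self_eq_norm_sq_to_K, Complex.conj_ofReal]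
      push_cast
      rfl
    rw [ContinuousLinearMap.reApplyInnerSelf_apply, sub_apply, inner_sub_left,
      sum_apply, sum_inner, h2, Finset.sum_congr rfl fun j _ => h1 j,
      ← Complex.ofReal_sum, ← Complex.ofReal_sub]
    exact (sub_nonneg.2 (h x)).trans_eq (Complex.ofReal_re _).symm

/-- Orthogonality of the characters of `ℤ / r`. -/
theorem sum_conj_pow_mul_pow {r : ℕ} {ω : ℂ} (hω : IsPrimitiveRoot ω r) (k l : Fin r) :
    ∑ j : Fin r, (starRingEnd ℂ) (ω ^ (j * k : ℕ)) * ω ^ (j * l : ℕ) =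
      if k = l then (r : ℂ) else 0 := by
  have hr : r ≠ 0 := (Fin.pos k).ne'
  have hnorm : ∀ n : ℕ, (starRingEnd ℂ) (ω ^ n) * ω ^ n = 1 := fun n => by
    rw [mul_comm, Complex.mul_conj, Complex.normSq_eq_norm_sq, norm_pow, hω.norm'_eq_one hr]
    simp
  set z : ℂ := (starRingEnd ℂ) (ω ^ (k : ℕ)) * ω ^ (l : ℕ) with hz
  have hterm : ∀ j : Fin r, (starRingEnd ℂ) (ω ^ (j * k : ℕ)) * ω ^ (j * l : ℕ) = z ^ (j : ℕ) :=
    fun j => by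
      rw [hz, mul_pow, ← map_pow, ← pow_mul, ← pow_mul, mul_comm (k : ℕ), mul_comm (l : ℕ)]
  simp only [hterm, Fin.sum_univ_eq_sum_range (fun j => z ^ j) r]
  split_ifs with hkl
  · subst hkl
    simp [hz.trans (hnorm _)]
  · have hz1 : z - 1 ≠ 0 := fun h => hkl <| by
      have h1 : ω ^ (k : ℕ) * z = ω ^ (l : ℕ) := by
        rw [hz, ← mul_assoc, mul_comm (ω ^ (k : ℕ)), hnorm, one_mul]
      rw [sub_eq_zero.1 h, mul_one] at h1
      exact Fin.ext (hω.pow_inj k.2 l.2 h1)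
    have hzr : z ^ r = 1 := by
      rw [hz, mul_pow, ← map_pow, pow_right_comm, pow_right_comm ω l, hω.pow_eq_one]
      simp
    refine (mul_eq_zero.1 ?_).resolve_left hz1
    rw [mul_geom_sum, hzr, sub_self]

/-- Parseval's identity for the discrete Fourier transform of a family of vectors. -/
theorem sum_norm_sq_sum_pow_smul {r : ℕ} {ω : ℂ} (hω : IsPrimitiveRoot ω r) (y : Fin r → S) :
    ∑ j : Fin r, ‖∑ l : Fin r, ω ^ (j * l : ℕ) • y l‖ ^ 2 = r * ∑ l, ‖y l‖ ^ 2 := by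
  apply Complex.ofReal_injective
  have h : ∀ x : S, ((‖x‖ ^ 2 : ℝ) : ℂ) = inner ℂ x x := fun x => by
    rw [inner_self_eq_norm_sq_to_K]; norm_cast
  rw [Complex.ofReal_sum, Complex.ofReal_mul, Complex.ofReal_sum]
  have hexpand : ∀ j : Fin r, inner ℂ (∑ l : Fin r, ω ^ (j * l : ℕ) • y l)
      (∑ l : Fin r, ω ^ (j * l : ℕ) • y l) = ∑ k : Fin r, ∑ l : Fin r,
        ((starRingEnd ℂ) (ω ^ (j * k : ℕ)) * ω ^ (j * l : ℕ)) * inner ℂ (y k) (y l) := fun j => by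
    rw [sum_inner]
    refine Finset.sum_congr rfl fun k _ => ?_
    rw [inner_sum]
    refine Finset.sum_congr rfl fun l _ => ?_
    rw [inner_smul_left, inner_smul_right, mul_assoc]
  simp only [h, hexpand]
  rw [Finset.sum_comm, Finset.mul_sum]
  refine Finset.sum_congr rfl fun k _ => ?_
  rw [Finset.sum_comm]
  simp_rw [← Finset.sum_mul, sum_conj_pow_mul_pow hω]
  simp

/-- Averaged over the `r` choices of Fourier phases, the Gram operator of a block is diagonal in the
basis `e` with entries `‖u l‖ ^ 2`, hence at most `m`. -/
theorem sum_star_mul_synthesisOperator_le [CompleteSpace S] {r : ℕ} {ω : ℂ}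
    (hω : IsPrimitiveRoot ω r) (e : OrthonormalBasis (Fin r) ℂ S) {u : Fin r → S} {m : ℝ}
    (hu : ∀ l, ‖u l‖ ^ 2 ≤ m) :
    ∑ j : Fin r, star (synthesisOperator e fun l => ω ^ (j * l : ℕ) • u l) *
      synthesisOperator e (fun l => ω ^ (j * l : ℕ) • u l) ≤ (r * m) • (1 : S →L[ℂ] S) := by
  refine sum_star_mul_self_le_smul_one _ fun x => ?_
  simp only [synthesisOperator_apply, smul_comm (inner ℂ _ x)]
  rw [sum_norm_sq_sum_pow_smul hω, mul_assoc, ← e.sum_sq_norm_inner_right x, Finset.mul_sum _ _ m]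
  gcongr with l
  rw [norm_smul, mul_pow, mul_comm]
  gcongr
  exact hu l

end Block

/-! ### The choice of permutation and phases -/

/-- Each block contributes the frame operator of its vectors, and neither the phases nor the order
of the vectors affect the total. -/
theorem sum_blockOperator_comp_adjoint {r T : ℕ} {S : Type*} [NormedAddCommGroup S]
    [InnerProductSpace ℂ S] [CompleteSpace S] (e : OrthonormalBasis (Fin r) ℂ S)
    {v : Fin (T * r) → S} (hv : IsParsevalFrame v) (π : Equiv.Perm (Fin (T * r)))
    (θ : Fin (T * r) → ℝ) :
    ∑ t : Fin T, (blockOperator e v π θ t).comp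
      (ContinuousLinearMap.adjoint (blockOperator e v π θ t)) = ContinuousLinearMap.id ℂ S := by
  have h : ∀ t, (blockOperator e v π θ t).comp
      (ContinuousLinearMap.adjoint (blockOperator e v π θ t)) =
      ∑ l : Fin r, InnerProductSpace.rankOne ℂ (v (π (finProdFinEquiv (t, l))))
        (v (π (finProdFinEquiv (t, l)))) := fun t => by
    refine (synthesisOperator_mul_star e _).trans ?_
    simp only [rankOne_phaseFrame]
  simp only [h]
  rw [← Fintype.sum_prod_type', finProdFinEquiv.sum_comp
    fun i => InnerProductSpace.rankOne ℂ (v (π i)) (v (π i)),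
    Equiv.sum_comp π fun i => InnerProductSpace.rankOne ℂ (v i) (v i)]
  exact hv

/-- The bound with explicit constants: sort the frame by decreasing norm and select the Fourier
phases of each block by the derandomised Chernoff bound. -/
theorem exists_perm_phase_norm_le {r T : ℕ} (hr : 2 ≤ r) {S : Type*} [NormedAddCommGroup S]
    [InnerProductSpace ℂ S] [CompleteSpace S] (e : OrthonormalBasis (Fin r) ℂ S)
    {v : Fin (T * r) → S} (hv : IsParsevalFrame v) :
    ∃ (π : Equiv.Perm (Fin (T * r))) (θ : Fin (T * r) → ℝ),
      ‖∑ t : Fin T, star (blockOperator e v π θ t) * blockOperator e v π θ t‖ ≤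
        Real.log r + 2 * (Real.exp 1 - 1) := by
  have hr0 : 0 < r := by omega
  have : Nonempty (Fin r) := ⟨⟨0, hr0⟩⟩
  have : Nontrivial S :=
    ⟨e ⟨0, hr0⟩, 0, fun h => by simpa [h] using e.norm_eq_one ⟨0, hr0⟩⟩
  set π : Equiv.Perm (Fin (T * r)) := Tuple.sort fun i => -‖v i‖ ^ 2
  have hπ : Antitone fun i => ‖v (π i)‖ ^ 2 := fun i j hij =>
    neg_le_neg_iff.1 (Tuple.monotone_sort (fun i => -‖v i‖ ^ 2) hij)
  set ω : ℂ := Complex.exp (2 * Real.pi * Complex.I / r) with hωdef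
  have hω : IsPrimitiveRoot ω r := Complex.isPrimitiveRoot_exp r hr0.ne'
  set u : Fin T → Fin r → Fin r → S := fun t j l =>
    ω ^ (j * l : ℕ) • v (π (finProdFinEquiv (t, l))) with hu
  have hu1 : ∀ t j x, ∑ l, ‖inner ℂ (u t j l) x‖ ^ 2 ≤ ‖x‖ ^ 2 := fun t j x => by
    have h1 : ∀ l, ‖inner ℂ (u t j l) x‖ = ‖inner ℂ (v (π (finProdFinEquiv (t, l)))) x‖ :=
      fun l => by
        simp [hu, hω.norm'_eq_one hr0.ne']
    simp only [h1]
    rw [← hv.sum_norm_inner_sq x, ← Equiv.sum_comp π fun i => ‖inner ℂ (v i) x‖ ^ 2,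
      ← finProdFinEquiv.sum_comp fun i => ‖inner ℂ (v (π i)) x‖ ^ 2, Fintype.sum_prod_type]
    exact Finset.single_le_sum (f := fun t : Fin T => ∑ l : Fin r,
      ‖inner ℂ (v (π (finProdFinEquiv (t, l)))) x‖ ^ 2) (fun _ _ => by positivity)
      (Finset.mem_univ t)
  -- the first vector of a block is its longest one
  set m : Fin T → ℝ := fun t => ‖v (π (finProdFinEquiv (t, ⟨0, hr0⟩)))‖ ^ 2 with hm
  have hm2 : ∑ t, m t ≤ 2 :=
    sum_leading_le_of_antitone hr0 hπ (fun _ => by positivity) (fun i => hv.norm_sq_le_one _) (by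
      rw [Equiv.sum_comp π fun i => ‖v i‖ ^ 2, hv.sum_norm_sq e, Fintype.card_fin])
  set X : Fin T → Fin r → S →L[ℂ] S := fun t j =>
    star (synthesisOperator e (u t j)) * synthesisOperator e (u t j) with hX
  have hX0 : ∀ t j, 0 ≤ X t j := fun t j => star_mul_self_nonneg _
  have hX1 : ∀ t j, X t j ≤ 1 := fun t j => by
    rw [← CStarAlgebra.norm_le_one_iff_of_nonneg _ (hX0 t j), hX, CStarRing.norm_star_mul_self]
    have := norm_synthesisOperator_le_one e (hu1 t j)
    exact mul_le_one₀ this (norm_nonneg _) this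
  have hXm : ∀ t, ∑ j, X t j ≤ (Fintype.card (Fin r) * m t) • (1 : S →L[ℂ] S) := fun t => by
    rw [Fintype.card_fin]
    refine sum_star_mul_synthesisOperator_le hω e fun l => hπ ?_
    rw [Fin.le_def]
    simp
  obtain ⟨J, hJ⟩ := (isPositiveTrace_reTrace e).exists_map_exp_sum_le (continuous_reTrace e) X m
    hX0 hX1 hXm Finset.univ
  -- the vector in position `(t, l)` gets the phase `ω ^ (J t * l)`
  set θ : Fin (T * r) → ℝ := fun i =>
    2 * Real.pi * (J (finProdFinEquiv.symm (π.symm i)).1 : ℕ) *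
      ((finProdFinEquiv.symm (π.symm i)).2 : ℕ) / r with hθ
  have hblock : ∀ t, blockOperator e v π θ t = synthesisOperator e (u t (J t)) := fun t => by
    rw [blockOperator, synthesisOperator]
    refine Finset.sum_congr rfl fun l _ => ?_
    congr 2
    simp only [phaseFrame, hu, hωdef]
    rw [← Complex.exp_nat_mul]
    simp only [hθ, Equiv.symm_apply_apply]
    congr 2
    push_cast
    ring
  refine ⟨π, θ, ?_⟩
  simp only [hblock]
  have hfin := (exp_norm_le_reTrace_exp e (Finset.sum_nonneg fun t _ => hX0 t (J t))).trans hJ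
  have hrpos : (0 : ℝ) < r := by exact_mod_cast hr0
  rw [reTrace_one e, Fintype.card_fin, ← Real.le_log_iff_exp_le (by positivity),
    Real.log_mul (Real.exp_pos _).ne' hrpos.ne', Real.log_exp] at hfin
  have he : 0 ≤ Real.exp 1 - 1 := by linarith [Real.add_one_le_exp (1 : ℝ)]
  linarith [mul_le_mul_of_nonneg_left hm2 he]

theorem proposition4 :
    ∃ c : ℝ, 0 < c ∧ ∀ r : ℕ, 2 ≤ r → ∃ T₀ : ℕ, 1 ≤ T₀ ∧ ∀ T : ℕ, T₀ ≤ T →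
      ∀ (S : Type*) [NormedAddCommGroup S] [InnerProductSpace ℂ S] [CompleteSpace S]
        (e : OrthonormalBasis (Fin r) ℂ S) (v : Fin (T * r) → S), IsParsevalFrame v →
        ∃ (π : Equiv.Perm (Fin (T * r))) (θ : Fin (T * r) → ℝ),
          ‖∑ t : Fin T, (ContinuousLinearMap.adjoint (blockOperator e v π θ t)).comp
              (blockOperator e v π θ t)‖ < c * Real.log r ∧
          ∑ t : Fin T, (blockOperator e v π θ t).comp
              (ContinuousLinearMap.adjoint (blockOperator e v π θ t)) =
            ContinuousLinearMap.id ℂ S := by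
  refine ⟨10, by norm_num, fun r hr => ⟨1, le_rfl, fun T _ S _ _ _ e v hv => ?_⟩⟩
  obtain ⟨π, θ, h⟩ := exists_perm_phase_norm_le hr e hv
  refine ⟨π, θ, lt_of_le_of_lt h ?_, sum_blockOperator_comp_adjoint e hv π θ⟩
  -- `2 * (e - 1) < 9 * log 2`, so the additive constant is absorbed into `10 * log r`
  have hlog : Real.log 2 ≤ Real.log r := Real.log_le_log two_pos (by exact_mod_cast hr)
  linarith [Real.log_two_gt_d9, Real.exp_one_lt_d9]
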